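/- **Theorem.** Let $N,d\ge 1$ be integers, let $I=[0,1]^N$, and let $H=(H_1,\dots,H_N)\in(0,1)^N$. Let $X_0=\{X_0(t),t\in I\}$ be a real-valued centered Gaussian random field with continuous covariance function $R(s,t)=\mathbb E[X_0(s)X_0(t)]$ satisfying: * (C1) there is a constant $0<c_1<\infty$ such that $\mathbb E\big[(X_0(s)-X_0(t))^2\big]\le c_1\sum_{j=1}^N|s_j-t_j|^{2H_j}$ for all $s,t\in I$; * (C2) there is a constant $c_2>0$ such that $\operatorname{Var}\big(X_0(t)\,\big|\,X_0(s)\big)\ge c_2\sum_{j=1}^N\min\{|s_j-t_j|^{2H_j},|t_j|^{2H_j}\}$ (almost surely) for all $s,t\in I$, where the left-hand side is the conditional variance of $X_0(t)$ given $X_0(s)$. Let $X=\{X(t),t\in I\}$, $X(t)=(X_1(t),\dots,X_d(t))$, be a (jointly measurable) $\mathbb R^d$-valued random field on a probability space $(\Omega,\mathscr F,\mathbb P)$ whose coordinate fields $X_1,\dots,X_d$ are independent copies of $X_0$. For $x\in\mathbb R^d$ and $\varepsilon>0$ put $$L_\varepsilon(x,I,X)=\int_I p_\varepsilon(X(s)-x)\,ds,\qquad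 p_\varepsilon(y)=\frac1{(2\pi\varepsilon)^{d/2}}\exp\Big(-\frac{\|y\|^2}{2\varepsilon}\Big),\quad y\in\mathbb R^d.$$ Then, for every $x\in\mathbb R^d$, $L_\varepsilon(x,I,X)$ converges in $L^2(\Omega,\mathbb P)$ as $\varepsilon\to0^+$ to a limit $L(x,I,X)$ (called the local time of $X$ at level $x$ on $I$) if and only if $\sum_{j=1}^N 1/H_j>d$. -/

import Mathlib

open MeasureTheory ProbabilityTheory Filter
open scoped Topology

noncomputable section

/-- The parameter rectangle `I = [0, 1]^N`. -/
abbrev unitCube (N : ℕ) : Type := Set.Icc (0 : Fin N → ℝ) 1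

/-- Lebesgue measure on `I`. -/
def lebesgueCube (N : ℕ) : Measure (unitCube N) :=
  Measure.comap Subtype.val (volume : Measure (Fin N → ℝ))

/-- `X₀` is a real-valued centered Gaussian random field on `I` with continuous covariance
function `R(s, t) = E[X₀(s) X₀(t)]`. -/
structure IsCenteredGaussianField {N : ℕ} {Ω₀ : Type*} [MeasurableSpace Ω₀]
    (X₀ : unitCube N → Ω₀ → ℝ) (P₀ : Measure Ω₀) : Prop where
  measurable : ∀ t, Measurable (X₀ t)
  gaussian : IsGaussianProcess X₀ P₀
  centered : ∀ t, ∫ ω, X₀ t ω ∂P₀ = 0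
  continuous_cov : Continuous fun p : unitCube N × unitCube N => ∫ ω, X₀ p.1 ω * X₀ p.2 ω ∂P₀

/-- The coordinate fields of the `ℝ^d`-valued random field `X` are independent copies of the
real-valued random field `X₀` (which may live on another probability space). -/
structure CoordsIndepCopies {N d : ℕ} {Ω Ω₀ : Type*} [MeasurableSpace Ω] [MeasurableSpace Ω₀]
    (X : unitCube N → Ω → EuclideanSpace ℝ (Fin d)) (P : Measure Ω)
    (X₀ : unitCube N → Ω₀ → ℝ) (P₀ : Measure Ω₀) : Prop where
  indep : iIndepFun (fun (i : Fin d) (ω : Ω) (t : unitCube N) => X t ω i) P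
  copy : ∀ i : Fin d,
    IdentDistrib (fun (ω : Ω) (t : unitCube N) => X t ω i) (fun (ω : Ω₀) (t : unitCube N) => X₀ t ω)
      P P₀

/-- Condition (C1). -/
def CondC1 {N : ℕ} {Ω₀ : Type*} [MeasurableSpace Ω₀]
    (X₀ : unitCube N → Ω₀ → ℝ) (P₀ : Measure Ω₀) (H : Fin N → ℝ) : Prop :=
  ∃ c₁ : ℝ, 0 < c₁ ∧ ∀ s t : unitCube N,
    ∫ ω, (X₀ s ω - X₀ t ω) ^ 2 ∂P₀ ≤ c₁ * ∑ j, |s.1 j - t.1 j| ^ (2 * H j)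

/-- Condition (C2). The conditional variance of `X₀(t)` given `X₀(s)` is the one with respect to
the σ-algebra generated by `X₀(s)`, and the lower bound holds almost surely. -/
def CondC2 {N : ℕ} {Ω₀ : Type*} [MeasurableSpace Ω₀]
    (X₀ : unitCube N → Ω₀ → ℝ) (P₀ : Measure Ω₀) (H : Fin N → ℝ) : Prop :=
  ∃ c₂ : ℝ, 0 < c₂ ∧ ∀ s t : unitCube N, ∀ᵐ ω ∂P₀,
    c₂ * ∑ j, min (|s.1 j - t.1 j| ^ (2 * H j)) (|t.1 j| ^ (2 * H j)) ≤
      condVar (MeasurableSpace.comap (X₀ s) inferInstance) (X₀ t) P₀ ω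

/-- The heat kernel `p_ε(x) = (2πε)^{-d/2} exp(-‖x‖² / (2ε))` on `ℝ^d`. -/
def heatKernel {d : ℕ} (ε : ℝ) (x : EuclideanSpace ℝ (Fin d)) : ℝ :=
  1 / (2 * Real.pi * ε) ^ ((d : ℝ) / 2) * Real.exp (-(‖x‖ ^ 2 / (2 * ε)))

/-- `L_ε(x, I, X) = ∫_I p_ε(X(s) - x) ds`, a random variable. -/
def approxLocalTime {N d : ℕ} {Ω : Type*} (X : unitCube N → Ω → EuclideanSpace ℝ (Fin d))
    (x : EuclideanSpace ℝ (Fin d)) (ε : ℝ) (ω : Ω) : ℝ :=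
  ∫ s, heatKernel ε (X s ω - x) ∂(lebesgueCube N)

/-- `L` is the local time `L(x, I, X)`: the limit of `L_ε(x, I, X)` in `L²(Ω, P)` as `ε → 0+`. -/
def IsLocalTime {N d : ℕ} {Ω : Type*} [MeasurableSpace Ω]
    (X : unitCube N → Ω → EuclideanSpace ℝ (Fin d)) (P : Measure Ω)
    (x : EuclideanSpace ℝ (Fin d)) (L : Ω → ℝ) : Prop :=
  MemLp L 2 P ∧
    Tendsto (fun ε : ℝ => eLpNorm (fun ω => approxLocalTime X x ε ω - L ω) 2 P) (𝓝[>] 0) (𝓝 0)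

end

/-!
The inner product of `L_ε` and `L_δ` in `L²(P)` is the integral over `I × I` of the joint density at
`(x, x)` of `X(s) + √ε Z` and `X(t) + √δ W`, where `Z`, `W` are independent standard Gaussian
vectors. This density is at most `D(s, t) ^ (-d / 2)`, where `D(s, t)` is the determinant of the
covariance matrix of `(X₀(s), X₀(t))`, and it converges to the joint density of `X(s)` and `X(t)`
as `ε, δ → 0`.

By (C2), `D(s, t)` is at least a constant times
`(∑ j, s_j ^ (2 H_j)) * ∑ j, (min |s_j - t_j| t_j) ^ (2 H_j)`. With `Q = ∑ j, 1 / H_j`, the weighted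
AM-GM inequality with weights `1 / (H_j Q)` bounds this below by
`∏ j, (s_j * min |s_j - t_j| t_j) ^ (2 / Q)`, so that `D ^ (-d / 2)` is dominated by a product of
functions of `(s_j, t_j)` that are integrable when `d < Q`; dominated convergence then shows that
`L_ε` is Cauchy in `L²(P)`.

Conversely, Fatou's lemma bounds the integral of the joint density of `X(s)` and `X(t)` at `(x, x)`
by the second moment of the local time. By (C1) and (C2), on a strip along the diagonal in which
`|s_j - t_j| ^ (2 H_j) ≤ r`, of measure of order `r ^ (Q / 2)`, this density is at least of order
`r ^ (-d / 2)`. If `Q ≤ d`, its integral over the strip therefore stays bounded away from zero while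
the measure of the strip tends to zero, so the density is not integrable.
-/

noncomputable section

/-- The density at `(x, y)` of the centered Gaussian law on `ℝ²` with covariance matrix
`[[A, b], [b, C]]`, for `A * C - b ^ 2 > 0`. -/
def bivariateGaussianPDF (A b C x y : ℝ) : ℝ :=
  (2 * Real.pi * √(A * C - b ^ 2))⁻¹ *
    Real.exp (-((C * x ^ 2 - 2 * b * x * y + A * y ^ 2) / (2 * (A * C - b ^ 2))))

lemma bivariateGaussianPDF_nonneg (A b C x y : ℝ) : 0 ≤ bivariateGaussianPDF A b C x y := by
  unfold bivariateGaussianPDF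
  positivity

lemma bivariateGaussianPDF_le_inv_sqrt {A b C D : ℝ} (hA : 0 ≤ A) (hD : 0 < D)
    (hdet : D ≤ A * C - b ^ 2) (x y : ℝ) : bivariateGaussianPDF A b C x y ≤ (√D)⁻¹ := by
  have hquad : 0 ≤ C * x ^ 2 - 2 * b * x * y + A * y ^ 2 := by
    rcases hA.eq_or_lt with rfl | hA
    · nlinarith [sq_nonneg b]
    · have : A * (C * x ^ 2 - 2 * b * x * y + A * y ^ 2)
          = (A * y - b * x) ^ 2 + (A * C - b ^ 2) * x ^ 2 := by ring
      refine nonneg_of_mul_nonneg_right ?_ hA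
      rw [this]
      exact add_nonneg (sq_nonneg _) (mul_nonneg (hD.le.trans hdet) (sq_nonneg x))
  have hsqrt : √D ≤ 2 * Real.pi * √(A * C - b ^ 2) := by
    nlinarith [Real.sqrt_le_sqrt hdet, Real.pi_gt_three, Real.sqrt_nonneg D]
  calc bivariateGaussianPDF A b C x y
      ≤ (2 * Real.pi * √(A * C - b ^ 2))⁻¹ * 1 := by
        unfold bivariateGaussianPDF
        gcongr
        exact Real.exp_le_one_iff.2 (neg_nonpos.2 (div_nonneg hquad (by linarith)))
    _ ≤ (√D)⁻¹ := by
        rw [mul_one]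
        exact inv_anti₀ (Real.sqrt_pos.2 hD) hsqrt

lemma integral_cexp_neg_mul_sq_div_two_add_mul {v : ℝ} (hv : 0 < v) (z : ℂ) :
    ∫ ξ : ℝ, Complex.exp (-(v * ξ ^ 2) / 2 + z * ξ) =
      √(2 * Real.pi / v) * Complex.exp (z ^ 2 / (2 * v)) := by
  have hv' : (v : ℂ) ≠ 0 := by exact_mod_cast hv.ne'
  have hre : (-(v / 2 : ℂ)).re < 0 := by
    rw [Complex.neg_re, ← Complex.ofReal_ofNat, ← Complex.ofReal_div, Complex.ofReal_re]
    linarith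
  have hsqrt : ((√(2 * Real.pi / v) : ℝ) : ℂ) = (Real.pi / -(-(v / 2)) : ℂ) ^ (1 / 2 : ℂ) := by
    rw [Real.sqrt_eq_rpow, Complex.ofReal_cpow (by positivity)]
    push_cast
    congr 1
    field_simp
  calc ∫ ξ : ℝ, Complex.exp (-(v * ξ ^ 2) / 2 + z * ξ)
      = ∫ ξ : ℝ, Complex.exp (-(v / 2 : ℂ) * ξ ^ 2 + z * ξ + 0) := by
        congr with ξ
        ring_nf
    _ = √(2 * Real.pi / v) * Complex.exp (z ^ 2 / (2 * v)) := by
        rw [integral_cexp_quadratic hre, hsqrt]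
        congr 2
        field_simp
        ring

lemma ofReal_gaussianPDFReal_eq_integral (m : ℝ) {v : NNReal} (hv : v ≠ 0) (u : ℝ) :
    (gaussianPDFReal m v u : ℂ) = (2 * Real.pi : ℂ)⁻¹ *
      ∫ ξ : ℝ, Complex.exp (-((v : ℝ) * ξ ^ 2) / 2 + Complex.I * (u - m) * ξ) := by
  have hv' : (0 : ℝ) < v := by positivity
  have hexp : (Complex.I * (u - m)) ^ 2 / (2 * (v : ℝ)) = ((-(u - m) ^ 2 / (2 * v) : ℝ) : ℂ) := by
    rw [mul_pow, Complex.I_sq]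
    push_cast
    ring
  have hsqrt : (√(2 * Real.pi * v))⁻¹ = (2 * Real.pi)⁻¹ * √(2 * Real.pi / v) := by
    rw [Real.sqrt_div (by positivity), Real.sqrt_mul (by positivity)]
    have := Real.sqrt_pos.2 hv'
    have := Real.sqrt_pos.2 Real.two_pi_pos
    field_simp
    rw [Real.sq_sqrt (by positivity)]
  rw [gaussianPDFReal_def, integral_cexp_neg_mul_sq_div_two_add_mul hv', hexp,
    ← Complex.ofReal_exp, hsqrt]
  push_cast
  ring

lemma ofReal_gaussianPDFReal_mul_gaussianPDFReal_eq_integral (x y : ℝ) {ε δ : NNReal}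
    (hε : ε ≠ 0) (hδ : δ ≠ 0) (u v : ℝ) :
    ((gaussianPDFReal x ε u * gaussianPDFReal y δ v : ℝ) : ℂ) =
      ((2 * Real.pi : ℂ) ^ 2)⁻¹ * ∫ p : ℝ × ℝ,
        Complex.exp (-((ε : ℝ) * p.1 ^ 2) / 2 + Complex.I * (u - x) * p.1) *
        Complex.exp (-((δ : ℝ) * p.2 ^ 2) / 2 + Complex.I * (v - y) * p.2)
          ∂(volume.prod volume) := by
  rw [integral_prod_mul
      (fun ξ : ℝ => Complex.exp (-((ε : ℝ) * ξ ^ 2) / 2 + Complex.I * (u - x) * ξ))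
      (fun η : ℝ => Complex.exp (-((δ : ℝ) * η ^ 2) / 2 + Complex.I * (v - y) * η)),
    Complex.ofReal_mul, ofReal_gaussianPDFReal_eq_integral x hε,
    ofReal_gaussianPDFReal_eq_integral y hδ]
  ring

lemma integral_cexp_neg_quadratic_form {A b C : ℝ} (hC : 0 < C) (x y ξ : ℝ) :
    ∫ η : ℝ, Complex.exp (-(A * ξ ^ 2 + 2 * b * ξ * η + C * η ^ 2) / 2 -
        Complex.I * (ξ * x + η * y)) =
      (√(2 * Real.pi / C) * Complex.exp (-(y ^ 2 / (2 * C)))) *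
        Complex.exp (-(((A * C - b ^ 2) / C : ℝ) * ξ ^ 2) / 2 +
          Complex.I * (b * y / C - x) * ξ) := by
  have hC' : (C : ℂ) ≠ 0 := by exact_mod_cast hC.ne'
  have hsplit (η : ℝ) : Complex.exp (-(A * ξ ^ 2 + 2 * b * ξ * η + C * η ^ 2) / 2 -
      Complex.I * (ξ * x + η * y)) = Complex.exp (-(A * ξ ^ 2) / 2 - Complex.I * (ξ * x)) *
        Complex.exp (-(C * η ^ 2) / 2 + (-(b * ξ) - Complex.I * y) * η) := by
    rw [← Complex.exp_add]
    ring_nf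
  simp_rw [hsplit]
  rw [integral_const_mul, integral_cexp_neg_mul_sq_div_two_add_mul hC, mul_left_comm, mul_assoc,
    ← Complex.exp_add, ← Complex.exp_add]
  congr 2
  push_cast
  field_simp
  ring_nf
  rw [Complex.I_sq]
  ring

lemma integral_integral_cexp_eq_bivariateGaussianPDF {A b C : ℝ} (hC : 0 < C)
    (hD : 0 < A * C - b ^ 2) (x y : ℝ) :
    ∫ ξ : ℝ, ∫ η : ℝ, Complex.exp (-(A * ξ ^ 2 + 2 * b * ξ * η + C * η ^ 2) / 2 -
        Complex.I * (ξ * x + η * y)) =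
      (2 * Real.pi : ℂ) ^ 2 * bivariateGaussianPDF A b C x y := by
  have hv : 0 < (A * C - b ^ 2) / C := by positivity
  have hsqrt : √(2 * Real.pi / C) * √(2 * Real.pi / ((A * C - b ^ 2) / C)) =
      (2 * Real.pi) ^ 2 * (2 * Real.pi * √(A * C - b ^ 2))⁻¹ := by
    have := Real.sqrt_pos.2 hD
    have hprod : 2 * Real.pi / C * (2 * Real.pi / ((A * C - b ^ 2) / C)) =
        (2 * Real.pi) ^ 2 / (A * C - b ^ 2) := by field_simp
    rw [← Real.sqrt_mul (by positivity), hprod, Real.sqrt_div (by positivity),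
      Real.sqrt_sq (by positivity)]
    field_simp
  have hquad : -(y ^ 2 / (2 * C)) - (b * y / C - x) ^ 2 / (2 * ((A * C - b ^ 2) / C)) =
      -((C * x ^ 2 - 2 * b * x * y + A * y ^ 2) / (2 * (A * C - b ^ 2))) := by
    obtain ⟨D, hAD⟩ : ∃ D, A = (D + b ^ 2) / C := ⟨A * C - b ^ 2, by field_simp; ring⟩
    have hdet : A * C - b ^ 2 = D := by rw [hAD]; field_simp; ring
    rw [hdet] at hD ⊢
    rw [hAD]
    field_simp
    ring
  have hexp : -(y ^ 2 / (2 * C) : ℂ) +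
        (Complex.I * (b * y / C - x)) ^ 2 / (2 * ((A * C - b ^ 2) / C : ℝ)) =
      ((-((C * x ^ 2 - 2 * b * x * y + A * y ^ 2) / (2 * (A * C - b ^ 2))) : ℝ) : ℂ) := by
    rw [← hquad, mul_pow, Complex.I_sq]
    push_cast
    ring
  simp_rw [integral_cexp_neg_quadratic_form hC]
  rw [integral_const_mul, integral_cexp_neg_mul_sq_div_two_add_mul hv, mul_mul_mul_comm,
    ← Complex.exp_add, hexp, ← Complex.ofReal_mul, hsqrt, bivariateGaussianPDF]
  push_cast
  ring

section GaussianPair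

variable {Ω : Type*} {mΩ : MeasurableSpace Ω} {P : Measure Ω} {U V : Ω → ℝ}

/-- The determinant of the covariance matrix of the pair `(U, V)`. -/
def covDet (U V : Ω → ℝ) (P : Measure Ω) : ℝ := Var[U; P] * Var[V; P] - cov[U, V; P] ^ 2

lemma variance_mul_add_mul [IsFiniteMeasure P] (hU : MemLp U 2 P) (hV : MemLp V 2 P) (ξ η : ℝ) :
    Var[fun ω => ξ * U ω + η * V ω; P] =
      Var[U; P] * ξ ^ 2 + 2 * cov[U, V; P] * ξ * η + Var[V; P] * η ^ 2 := by
  rw [variance_fun_add (hU.const_mul ξ) (hV.const_mul η), variance_const_mul, variance_const_mul,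
    covariance_const_mul_left, covariance_const_mul_right]
  ring

lemma covDet_nonneg [IsFiniteMeasure P] (hU : MemLp U 2 P) (hV : MemLp V 2 P) :
    0 ≤ covDet U V P := by
  have hquad (ξ : ℝ) :
      0 ≤ Var[U; P] * (ξ * ξ) + (2 * cov[U, V; P]) * ξ + Var[V; P] := by
    have hnonneg := variance_nonneg (fun ω => ξ * U ω + 1 * V ω) P
    rw [variance_mul_add_mul hU hV] at hnonneg
    linarith
  have hdiscrim := discrim_le_zero hquad
  unfold discrim at hdiscrim
  unfold covDet
  linarith

lemma covDet_le_variance_mul_variance_sub [IsFiniteMeasure P] (hU : MemLp U 2 P)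
    (hV : MemLp V 2 P) : covDet U V P ≤ Var[U; P] * Var[U - V; P] := by
  rw [variance_sub hU hV, covDet]
  linarith [sq_nonneg (Var[U; P] - cov[U, V; P])]

lemma covDet_add_mul_le {ε δ : ℝ} (hε : 0 ≤ ε) (hδ : 0 ≤ δ) :
    covDet U V P + ε * δ ≤
      (Var[U; P] + ε) * (Var[V; P] + δ) - cov[U, V; P] ^ 2 := by
  unfold covDet
  linarith [mul_nonneg (variance_nonneg U P) hδ, mul_nonneg hε (variance_nonneg V P)]

lemma integral_cexp_mul_add_mul (hUV : HasGaussianLaw (fun ω => (U ω, V ω)) P) (ξ η : ℝ) :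
    ∫ ω, Complex.exp (Complex.I * (ξ * U ω + η * V ω)) ∂P =
      Complex.exp (Complex.I * (ξ * (P[U] : ℝ) + η * (P[V] : ℝ)) -
        (Var[U; P] * ξ ^ 2 + 2 * cov[U, V; P] * ξ * η + Var[V; P] * η ^ 2 : ℝ) / 2) := by
  have := hUV.isProbabilityMeasure
  have hU := hUV.fst
  have hV := hUV.snd
  have hlin : HasGaussianLaw (fun ω => ξ * U ω + η * V ω) P :=
    hUV.map_fun (ξ • ContinuousLinearMap.fst ℝ ℝ ℝ + η • ContinuousLinearMap.snd ℝ ℝ ℝ)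
  have hchar := hlin.charFun_map_eq 1
  rw [charFun_apply_real, integral_map hlin.aemeasurable (by fun_prop)] at hchar
  simp only [Complex.ofReal_one, one_mul, RCLike.inner_apply, conj_trivial, mul_one] at hchar
  rw [integral_add (hU.integrable.const_mul ξ) (hV.integrable.const_mul η),
    integral_const_mul, integral_const_mul, variance_mul_add_mul hU.memLp_two hV.memLp_two] at hchar
  convert hchar using 3
  all_goals
    push_cast
    ring_nf

lemma integrable_cexp_neg_sq_mul_cexp_neg_sq [IsFiniteMeasure P] (hU : AEMeasurable U P)
    (hV : AEMeasurable V P) {ε δ : ℝ} (hε : 0 < ε) (hδ : 0 < δ) (x y : ℝ) :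
    Integrable (fun p : Ω × (ℝ × ℝ) =>
      Complex.exp (-(ε * p.2.1 ^ 2) / 2 + Complex.I * (U p.1 - x) * p.2.1) *
      Complex.exp (-(δ * p.2.2 ^ 2) / 2 + Complex.I * (V p.1 - y) * p.2.2))
      (P.prod (volume.prod volume)) := by
  have hgauss : Integrable (fun p : ℝ × ℝ => Real.exp (-(ε / 2) * p.1 ^ 2) *
      Real.exp (-(δ / 2) * p.2 ^ 2)) (volume.prod volume) :=
    (integrable_exp_neg_mul_sq (half_pos hε)).mul_prod (integrable_exp_neg_mul_sq (half_pos hδ))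
  have : AEMeasurable (fun p : Ω × (ℝ × ℝ) => U p.1) (P.prod (volume.prod volume)) :=
    hU.comp_fst
  have : AEMeasurable (fun p : Ω × (ℝ × ℝ) => V p.1) (P.prod (volume.prod volume)) :=
    hV.comp_fst
  refine (hgauss.comp_snd P).mono' ?_ (ae_of_all _ fun p => ?_)
  · exact AEMeasurable.aestronglyMeasurable (by fun_prop)
  · rw [norm_mul, Complex.norm_exp, Complex.norm_exp]
    apply le_of_eq
    congr 2 <;> simp [← Complex.ofReal_pow, ← Complex.ofReal_mul, ← Complex.ofReal_neg] <;> ring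

lemma integral_cexp_neg_sq_mul_cexp_neg_sq (hUV : HasGaussianLaw (fun ω => (U ω, V ω)) P)
    (ε δ x y ξ η : ℝ) :
    ∫ ω, Complex.exp (-(ε * ξ ^ 2) / 2 + Complex.I * (U ω - x) * ξ) *
        Complex.exp (-(δ * η ^ 2) / 2 + Complex.I * (V ω - y) * η) ∂P =
      Complex.exp (-((Var[U; P] + ε : ℝ) * ξ ^ 2 + 2 * (cov[U, V; P] : ℝ) * ξ * η +
        (Var[V; P] + δ : ℝ) * η ^ 2) / 2 -
        Complex.I * (ξ * (x - P[U] : ℝ) + η * (y - P[V] : ℝ))) := by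
  have hsplit (ω : Ω) : Complex.exp (-(ε * ξ ^ 2) / 2 + Complex.I * (U ω - x) * ξ) *
      Complex.exp (-(δ * η ^ 2) / 2 + Complex.I * (V ω - y) * η) =
      Complex.exp (-(ε * ξ ^ 2 + δ * η ^ 2) / 2 - Complex.I * (x * ξ + y * η)) *
      Complex.exp (Complex.I * (ξ * U ω + η * V ω)) := by
    rw [← Complex.exp_add, ← Complex.exp_add]
    ring_nf
  simp_rw [hsplit]
  rw [integral_const_mul, integral_cexp_mul_add_mul hUV, ← Complex.exp_add]
  push_cast
  ring_nf

lemma integral_gaussianPDFReal_mul_gaussianPDFReal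
    (hUV : HasGaussianLaw (fun ω => (U ω, V ω)) P) {ε δ : NNReal} (hε : ε ≠ 0) (hδ : δ ≠ 0)
    (x y : ℝ) :
    ∫ ω, gaussianPDFReal x ε (U ω) * gaussianPDFReal y δ (V ω) ∂P =
      bivariateGaussianPDF (Var[U; P] + ε) cov[U, V; P] (Var[V; P] + δ) (x - P[U]) (y - P[V]) := by
  have := hUV.isProbabilityMeasure
  have hε' : (0 : ℝ) < ε := by positivity
  have hδ' : (0 : ℝ) < δ := by positivity
  have hC : 0 < Var[V; P] + δ := add_pos_of_nonneg_of_pos (variance_nonneg V P) hδ'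
  have hD : 0 < (Var[U; P] + ε) * (Var[V; P] + δ) - cov[U, V; P] ^ 2 := by
    have hdet := covDet_nonneg hUV.fst.memLp_two hUV.snd.memLp_two
    exact (add_pos_of_nonneg_of_pos hdet (mul_pos hε' hδ')).trans_le
      (covDet_add_mul_le hε'.le hδ'.le)
  have hint := integrable_cexp_neg_sq_mul_cexp_neg_sq hUV.fst.aemeasurable hUV.snd.aemeasurable
    hε' hδ' x y
  have hint₂ := hint.integral_prod_right
  apply Complex.ofReal_injective
  rw [← integral_complex_ofReal]
  simp_rw [ofReal_gaussianPDFReal_mul_gaussianPDFReal_eq_integral x y hε hδ]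
  rw [integral_const_mul, integral_integral_swap hint]
  simp only [integral_cexp_neg_sq_mul_cexp_neg_sq hUV] at hint₂ ⊢
  rw [integral_prod _ hint₂, integral_integral_cexp_eq_bivariateGaussianPDF hC hD]
  have : (Real.pi : ℂ) ≠ 0 := by exact_mod_cast Real.pi_ne_zero
  field_simp

lemma le_variance_sub_of_le_condVar [IsProbabilityMeasure P] {m : MeasurableSpace Ω} (hm : m ≤ mΩ)
    (hU : MemLp U 2 P) (hUm : StronglyMeasurable[m] U) (hV : MemLp V 2 P) {v : ℝ}
    (hv : ∀ᵐ ω ∂P, v ≤ Var[V; P | m] ω) : v ≤ Var[V - U; P] := by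
  have hcondVar : Var[V; P | m] =ᵐ[P] Var[V - U; P | m] := by
    refine condExp_congr_ae ?_
    filter_upwards [condExp_sub (m := m) (hV.integrable one_le_two) (hU.integrable one_le_two)]
      with ω hω
    simp only [Pi.pow_apply, Pi.sub_apply] at hω ⊢
    rw [hω, condExp_of_stronglyMeasurable hm hUm (hU.integrable one_le_two)]
    ring
  calc v = ∫ _, v ∂P := by simp
    _ ≤ P[Var[V - U; P | m]] := by
      refine integral_mono_ae (integrable_const v) integrable_condVar ?_
      filter_upwards [hv, hcondVar] with ω hω hω'
      exact hω' ▸ hω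
    _ ≤ Var[V - U; P] := by
      rw [← integral_condVar_add_variance_condExp hm (hV.sub hU)]
      exact le_add_of_nonneg_right (variance_nonneg _ P)

lemma le_variance_of_le_condVar [IsProbabilityMeasure P] {m : MeasurableSpace Ω} (hm : m ≤ mΩ)
    (hV : MemLp V 2 P) {v : ℝ} (hv : ∀ᵐ ω ∂P, v ≤ Var[V; P | m] ω) : v ≤ Var[V; P] := by
  simpa using le_variance_sub_of_le_condVar hm MemLp.zero stronglyMeasurable_zero hV hv

lemma variance_mul_le_covDet_of_le_condVar [IsProbabilityMeasure P] (hUm : Measurable U)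
    (hU : MemLp U 2 P) (hV : MemLp V 2 P) {v : ℝ}
    (hv : ∀ᵐ ω ∂P, v ≤ condVar (MeasurableSpace.comap U inferInstance) V P ω) :
    Var[U; P] * v ≤ covDet U V P := by
  rcases (variance_nonneg U P).eq_or_lt with hvar | hvar
  · rw [← hvar, zero_mul]
    exact covDet_nonneg hU hV
  · -- `(cov[U, V] / Var[U]) • U` is the best linear predictor of `V` from `U`
    have hpredict := le_variance_sub_of_le_condVar hUm.comap_le
      (hU.const_mul (cov[U, V; P] / Var[U; P]))
      ((comap_measurable U).const_mul _).stronglyMeasurable hV hv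
    rw [variance_sub hV (hU.const_mul _), variance_const_mul, covariance_const_mul_right,
      covariance_comm V U] at hpredict
    calc Var[U; P] * v ≤ _ := mul_le_mul_of_nonneg_left hpredict hvar.le
      _ = covDet U V P := by
        unfold covDet
        field_simp
        ring

end GaussianPair

section Cube

variable (N : ℕ)

lemma measurePreserving_val_lebesgueCube :
    MeasurePreserving Subtype.val (lebesgueCube N)
      (Measure.pi fun _ : Fin N => (volume : Measure ℝ).restrict (Set.Icc 0 1)) := by
  refine ⟨measurable_subtype_coe, ?_⟩
  rw [lebesgueCube, map_comap_subtype_coe measurableSet_Icc, ← Measure.restrict_pi_pi, volume_pi]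
  congr 1
  exact (Set.pi_univ_Icc _ _).symm

instance : IsFiniteMeasure (lebesgueCube N) := by
  have h := (measurePreserving_val_lebesgueCube N).measure_preimage
    (s := Set.univ) MeasurableSet.univ.nullMeasurableSet
  exact ⟨by rw [← Set.preimage_univ (f := Subtype.val), h]; exact measure_lt_top _ _⟩

lemma measurePreserving_coords_lebesgueCube :
    MeasurePreserving (fun (p : unitCube N × unitCube N) (j : Fin N) => (p.1.1 j, p.2.1 j))
      ((lebesgueCube N).prod (lebesgueCube N))
      (Measure.pi fun _ : Fin N => ((volume : Measure ℝ).restrict (Set.Icc 0 1)).prod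
        ((volume : Measure ℝ).restrict (Set.Icc 0 1))) :=
  (measurePreserving_arrowProdEquivProdArrow ℝ ℝ (Fin N) _ _).symm.comp
    ((measurePreserving_val_lebesgueCube N).prod (measurePreserving_val_lebesgueCube N))

end Cube

section HeatKernel

variable {d : ℕ}

lemma heatKernel_nonneg {ε : ℝ} (hε : 0 < ε) (y : EuclideanSpace ℝ (Fin d)) :
    0 ≤ heatKernel ε y := by
  unfold heatKernel
  positivity

lemma norm_heatKernel_le {ε : ℝ} (hε : 0 < ε) (y : EuclideanSpace ℝ (Fin d)) :
    ‖heatKernel ε y‖ ≤ 1 / (2 * Real.pi * ε) ^ ((d : ℝ) / 2) := by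
  rw [Real.norm_of_nonneg (heatKernel_nonneg hε y), heatKernel]
  refine mul_le_of_le_one_right (by positivity) (Real.exp_le_one_iff.2 ?_)
  exact neg_nonpos.2 (by positivity)

lemma measurable_heatKernel (ε : ℝ) :
    Measurable (heatKernel ε : EuclideanSpace ℝ (Fin d) → ℝ) := by
  unfold heatKernel
  fun_prop

lemma heatKernel_sub_eq_prod_gaussianPDFReal (v : NNReal) (x y : EuclideanSpace ℝ (Fin d)) :
    heatKernel v (y - x) = ∏ i, gaussianPDFReal (x i) v (y i) := by
  have hv : (0 : ℝ) ≤ 2 * Real.pi * v := by positivity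
  simp only [heatKernel, gaussianPDFReal_def]
  rw [Finset.prod_mul_distrib, ← Real.exp_sum, EuclideanSpace.norm_sq_eq, Finset.prod_const,
    Finset.card_univ, Fintype.card_fin, Finset.sum_div, ← Finset.sum_neg_distrib]
  congr 1
  · rw [one_div, inv_pow, Real.sqrt_eq_rpow, ← Real.rpow_natCast, ← Real.rpow_mul hv]
    congr 2
    ring
  · simp only [PiLp.sub_apply, Real.norm_eq_abs, sq_abs, neg_div]

end HeatKernel

namespace IsCenteredGaussianField

variable {N : ℕ} {Ω₀ : Type*} [MeasurableSpace Ω₀] {P₀ : Measure Ω₀}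
  {X₀ : unitCube N → Ω₀ → ℝ}

lemma memLp_two (hX₀ : IsCenteredGaussianField X₀ P₀) (t : unitCube N) : MemLp (X₀ t) 2 P₀ :=
  (hX₀.gaussian.hasGaussianLaw_eval t).memLp_two

variable [IsProbabilityMeasure P₀]

lemma continuous_covariance (hX₀ : IsCenteredGaussianField X₀ P₀) :
    Continuous fun p : unitCube N × unitCube N => cov[X₀ p.1, X₀ p.2; P₀] := by
  simpa only [covariance_eq_sub (hX₀.memLp_two _) (hX₀.memLp_two _), hX₀.centered, mul_zero,
    sub_zero, Pi.mul_apply] using hX₀.continuous_cov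

lemma continuous_variance (hX₀ : IsCenteredGaussianField X₀ P₀) :
    Continuous fun t : unitCube N => Var[X₀ t; P₀] := by
  simpa only [Function.comp_def, id, covariance_self (hX₀.measurable _).aemeasurable] using
    hX₀.continuous_covariance.comp (continuous_id.prodMk continuous_id)

lemma measurable_covDet (hX₀ : IsCenteredGaussianField X₀ P₀) :
    Measurable fun p : unitCube N × unitCube N => covDet (X₀ p.1) (X₀ p.2) P₀ :=
  (((hX₀.continuous_variance.comp continuous_fst).mul
    (hX₀.continuous_variance.comp continuous_snd)).sub (hX₀.continuous_covariance.pow 2)).measurable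

end IsCenteredGaussianField

section TwoPointDensity

variable {N d : ℕ} {Ω₀ : Type*} [MeasurableSpace Ω₀] {P₀ : Measure Ω₀}
  {X₀ : unitCube N → Ω₀ → ℝ} {x : EuclideanSpace ℝ (Fin d)}

/-- The joint density at `(x, x)` of `X(s) + √ε Z` and `X(t) + √δ W`, where `p = (s, t)`, the
coordinates of `X` are independent copies of `X₀`, and `Z`, `W` are independent standard Gaussian
vectors of `ℝ^d`. For `ε = δ = 0` it is the joint density of `X(s)` and `X(t)`, provided that
the pair `(X₀(s), X₀(t))` is nondegenerate. -/
def twoPointDensity (X₀ : unitCube N → Ω₀ → ℝ) (P₀ : Measure Ω₀) (x : EuclideanSpace ℝ (Fin d))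
    (ε δ : ℝ) (p : unitCube N × unitCube N) : ℝ :=
  ∏ i, bivariateGaussianPDF (Var[X₀ p.1; P₀] + ε) cov[X₀ p.1, X₀ p.2; P₀] (Var[X₀ p.2; P₀] + δ)
    (x i) (x i)

lemma twoPointDensity_nonneg (ε δ : ℝ) (p : unitCube N × unitCube N) :
    0 ≤ twoPointDensity X₀ P₀ x ε δ p :=
  Finset.prod_nonneg fun _ _ => bivariateGaussianPDF_nonneg _ _ _ _ _

lemma IsCenteredGaussianField.measurable_twoPointDensity [IsProbabilityMeasure P₀]
    (hX₀ : IsCenteredGaussianField X₀ P₀) (x : EuclideanSpace ℝ (Fin d)) (ε δ : ℝ) :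
    Measurable (twoPointDensity X₀ P₀ x ε δ) := by
  have hcov := hX₀.continuous_covariance.measurable
  have hfst := (hX₀.continuous_variance.comp continuous_fst).measurable
    (α := unitCube N × unitCube N)
  have hsnd := (hX₀.continuous_variance.comp continuous_snd).measurable
    (α := unitCube N × unitCube N)
  simp only [Function.comp_def] at hfst hsnd
  unfold twoPointDensity bivariateGaussianPDF
  fun_prop

lemma tendsto_twoPointDensity {p : unitCube N × unitCube N}
    (hp : 0 < covDet (X₀ p.1) (X₀ p.2) P₀) :
    Tendsto (fun q : ℝ × ℝ => twoPointDensity X₀ P₀ x q.1 q.2 p)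
      (𝓝[>] 0 ×ˢ 𝓝[>] 0) (𝓝 (twoPointDensity X₀ P₀ x 0 0 p)) := by
  have hcont : ContinuousAt (fun q : ℝ × ℝ => twoPointDensity X₀ P₀ x q.1 q.2 p) (0, 0) := by
    unfold covDet at hp
    unfold twoPointDensity bivariateGaussianPDF
    refine tendsto_finsetProd _ fun i _ => ?_
    refine ContinuousAt.mul (ContinuousAt.inv₀ (by fun_prop) ?_) (ContinuousAt.rexp
      (ContinuousAt.neg (ContinuousAt.div (by fun_prop) (by fun_prop) ?_)))
    all_goals
      simp only [add_zero]
      positivity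
  refine hcont.tendsto.mono_left ?_
  rw [nhds_prod_eq]
  exact Filter.prod_mono nhdsWithin_le_nhds nhdsWithin_le_nhds

lemma twoPointDensity_le {p : unitCube N × unitCube N} {D ε δ : ℝ} (hD : 0 < D)
    (hdet : D ≤ covDet (X₀ p.1) (X₀ p.2) P₀) (hε : 0 ≤ ε) (hδ : 0 ≤ δ) :
    twoPointDensity X₀ P₀ x ε δ p ≤ D ^ (-((d : ℝ) / 2)) := by
  have hdet' := hdet.trans (le_of_add_le_of_nonneg_left (covDet_add_mul_le hε hδ)
    (mul_nonneg hε hδ))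
  calc twoPointDensity X₀ P₀ x ε δ p ≤ ∏ _ : Fin d, (√D)⁻¹ :=
        Finset.prod_le_prod (fun _ _ => bivariateGaussianPDF_nonneg _ _ _ _ _) fun _ _ =>
          bivariateGaussianPDF_le_inv_sqrt (add_nonneg (variance_nonneg _ P₀) hε) hD hdet' _ _
    _ = D ^ (-((d : ℝ) / 2)) := by
        rw [Finset.prod_const, Finset.card_univ, Fintype.card_fin, Real.sqrt_eq_rpow,
          ← Real.rpow_neg hD.le, ← Real.rpow_natCast, ← Real.rpow_mul hD.le]
        congr 1
        ring

end TwoPointDensity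

section SecondMoment

variable {N d : ℕ} {Ω Ω₀ : Type*} [MeasurableSpace Ω] [MeasurableSpace Ω₀]
  {P : Measure Ω} {P₀ : Measure Ω₀}
  {X₀ : unitCube N → Ω₀ → ℝ} {X : unitCube N → Ω → EuclideanSpace ℝ (Fin d)}

lemma integral_heatKernel_mul_heatKernel (hX₀ : IsCenteredGaussianField X₀ P₀)
    (hXmeas : Measurable (Function.uncurry X)) (hX : CoordsIndepCopies X P X₀ P₀)
    (x : EuclideanSpace ℝ (Fin d)) {ε δ : ℝ} (hε : 0 < ε) (hδ : 0 < δ) (s t : unitCube N) :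
    ∫ ω, heatKernel ε (X s ω - x) * heatKernel δ (X t ω - x) ∂P =
      twoPointDensity X₀ P₀ x ε δ (s, t) := by
  lift ε to NNReal using hε.le
  lift δ to NNReal using hδ.le
  let g (i : Fin d) (f : unitCube N → ℝ) : ℝ :=
    gaussianPDFReal (x i) ε (f s) * gaussianPDFReal (x i) δ (f t)
  have hg (i : Fin d) : Measurable (g i) :=
    ((measurable_gaussianPDFReal _ _).comp (measurable_pi_apply s)).mul
      ((measurable_gaussianPDFReal _ _).comp (measurable_pi_apply t))
  have hpath (i : Fin d) : Measurable fun ω (t : unitCube N) => X t ω i :=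
    measurable_pi_lambda _ fun t => (EuclideanSpace.proj (𝕜 := ℝ) i).continuous.measurable.comp
      (hXmeas.comp measurable_prodMk_left)
  calc ∫ ω, heatKernel ε (X s ω - x) * heatKernel δ (X t ω - x) ∂P
      = ∫ ω, ∏ i, g i (fun t => X t ω i) ∂P := by
        simp only [heatKernel_sub_eq_prod_gaussianPDFReal, ← Finset.prod_mul_distrib, g]
    _ = ∏ i, ∫ ω, g i (fun t => X t ω i) ∂P :=
        (hX.indep.comp g hg).integral_fun_prod_eq_prod_integral fun i =>
          ((hg i).comp (hpath i)).aestronglyMeasurable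
    _ = ∏ i, ∫ ω, g i (fun t => X₀ t ω) ∂P₀ :=
        Finset.prod_congr rfl fun i _ => ((hX.copy i).comp (hg i)).integral_eq
    _ = twoPointDensity X₀ P₀ x ε δ (s, t) := Finset.prod_congr rfl fun i _ => by
        have hlaw := integral_gaussianPDFReal_mul_gaussianPDFReal
          (hX₀.gaussian.hasGaussianLaw_prodMk (s := s) (t := t)) (NNReal.coe_pos.1 hε).ne'
          (NNReal.coe_pos.1 hδ).ne' (x i) (x i)
        rwa [hX₀.centered, hX₀.centered, sub_zero] at hlaw

lemma measurable_heatKernel_sub (hXmeas : Measurable (Function.uncurry X))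
    (x : EuclideanSpace ℝ (Fin d)) (ε : ℝ) :
    Measurable fun q : Ω × unitCube N => heatKernel ε (X q.2 q.1 - x) :=
  (measurable_heatKernel ε).comp ((hXmeas.comp measurable_swap).sub_const x)

lemma memLp_approxLocalTime [IsFiniteMeasure P] (hXmeas : Measurable (Function.uncurry X))
    (x : EuclideanSpace ℝ (Fin d)) {ε : ℝ} (hε : 0 < ε) : MemLp (approxLocalTime X x ε) 2 P :=
  MemLp.of_bound (measurable_heatKernel_sub hXmeas x
    ε).stronglyMeasurable.integral_prod_right'.aestronglyMeasurable _ <| ae_of_all _ fun _ =>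
    norm_integral_le_of_norm_le_const (ae_of_all _ fun _ => norm_heatKernel_le hε _)

lemma integrable_heatKernel_mul_heatKernel [IsFiniteMeasure P]
    (hXmeas : Measurable (Function.uncurry X)) (x : EuclideanSpace ℝ (Fin d)) {ε δ : ℝ}
    (hε : 0 < ε) (hδ : 0 < δ) :
    Integrable (fun q : Ω × (unitCube N × unitCube N) =>
      heatKernel ε (X q.2.1 q.1 - x) * heatKernel δ (X q.2.2 q.1 - x))
      (P.prod ((lebesgueCube N).prod (lebesgueCube N))) := by
  have hmeas := measurable_heatKernel_sub hXmeas x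
  refine Integrable.of_bound (((hmeas ε).comp (measurable_fst.prodMk measurable_snd.fst)).mul
    ((hmeas δ).comp (measurable_fst.prodMk measurable_snd.snd))).aestronglyMeasurable
    (1 / (2 * Real.pi * ε) ^ ((d : ℝ) / 2) * (1 / (2 * Real.pi * δ) ^ ((d : ℝ) / 2)))
    (ae_of_all _ fun q => ?_)
  rw [norm_mul]
  exact mul_le_mul (norm_heatKernel_le hε _) (norm_heatKernel_le hδ _) (norm_nonneg _)
    (by positivity)

lemma integral_approxLocalTime_mul [IsFiniteMeasure P] (hX₀ : IsCenteredGaussianField X₀ P₀)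
    (hXmeas : Measurable (Function.uncurry X)) (hX : CoordsIndepCopies X P X₀ P₀)
    (x : EuclideanSpace ℝ (Fin d)) {ε δ : ℝ} (hε : 0 < ε) (hδ : 0 < δ) :
    ∫ ω, approxLocalTime X x ε ω * approxLocalTime X x δ ω ∂P =
      ∫ p, twoPointDensity X₀ P₀ x ε δ p ∂((lebesgueCube N).prod (lebesgueCube N)) := by
  calc ∫ ω, approxLocalTime X x ε ω * approxLocalTime X x δ ω ∂P
      = ∫ ω, ∫ p : unitCube N × unitCube N, heatKernel ε (X p.1 ω - x) *
          heatKernel δ (X p.2 ω - x) ∂((lebesgueCube N).prod (lebesgueCube N)) ∂P := by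
        congr with ω
        exact (integral_prod_mul (fun s => heatKernel ε (X s ω - x))
          fun t => heatKernel δ (X t ω - x)).symm
    _ = ∫ p : unitCube N × unitCube N, ∫ ω, heatKernel ε (X p.1 ω - x) *
          heatKernel δ (X p.2 ω - x) ∂P ∂((lebesgueCube N).prod (lebesgueCube N)) :=
        integral_integral_swap (integrable_heatKernel_mul_heatKernel hXmeas x hε hδ)
    _ = ∫ p, twoPointDensity X₀ P₀ x ε δ p ∂((lebesgueCube N).prod (lebesgueCube N)) := by
        congr with p
        exact integral_heatKernel_mul_heatKernel hX₀ hXmeas hX x hε hδ p.1 p.2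

end SecondMoment

section MeanSquareLimits

lemma exists_tendsto_of_tendsto_inner {ι E : Type*} [NormedAddCommGroup E] [InnerProductSpace ℝ E]
    [CompleteSpace E] {l : Filter ι} [l.NeBot] {G : ι → E} {c : ℝ}
    (h : Tendsto (fun q : ι × ι => inner ℝ (G q.1) (G q.2)) (l ×ˢ l) (𝓝 c)) :
    ∃ g, Tendsto G l (𝓝 g) := by
  have hnorm : Tendsto (fun i => ‖G i‖ ^ 2) l (𝓝 c) := by
    simpa only [Function.comp_def, id, real_inner_self_eq_norm_sq] using
      h.comp (tendsto_id.prodMk tendsto_id)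
  have hdist : Tendsto (fun q : ι × ι => dist (G q.1) (G q.2)) (l ×ˢ l) (𝓝 0) := by
    have hsq := (((hnorm.comp tendsto_fst).sub (h.const_mul 2)).add
      (hnorm.comp tendsto_snd)).sqrt
    simpa only [Function.comp_def, ← norm_sub_sq_real, Real.sqrt_sq (norm_nonneg _), dist_eq_norm,
      show c - 2 * c + c = 0 by ring, Real.sqrt_zero] using hsq
  exact cauchy_map_iff_exists_tendsto.1 <|
    cauchy_map_iff.2 ⟨‹_›, tendsto_uniformity_iff_dist_tendsto_zero.2 hdist⟩

variable {Ω : Type*} [MeasurableSpace Ω] {P : Measure Ω}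

lemma inner_toLp_eq_integral_mul {f g : Ω → ℝ} (hf : MemLp f 2 P) (hg : MemLp g 2 P) :
    inner ℝ (hf.toLp f) (hg.toLp g) = ∫ ω, f ω * g ω ∂P := by
  rw [L2.inner_def]
  refine integral_congr_ae ?_
  filter_upwards [hf.coeFn_toLp, hg.coeFn_toLp] with ω hfω hgω
  rw [hfω, hgω, RCLike.inner_apply, conj_trivial, mul_comm]

lemma ofReal_integral_mul_self_eq_eLpNorm_sq {f : Ω → ℝ} (hf : MemLp f 2 P) :
    ENNReal.ofReal (∫ ω, f ω * f ω ∂P) = eLpNorm f 2 P ^ 2 := by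
  rw [← inner_toLp_eq_integral_mul hf hf, real_inner_self_eq_norm_sq, Lp.norm_toLp,
    ENNReal.ofReal_pow ENNReal.toReal_nonneg, ENNReal.ofReal_toReal hf.eLpNorm_ne_top]

lemma exists_tendsto_eLpNorm_of_tendsto_integral_mul {ι : Type*} {l : Filter ι} [l.NeBot]
    {F : ι → Ω → ℝ} (hF : ∀ᶠ i in l, MemLp (F i) 2 P) {c : ℝ}
    (h : Tendsto (fun q : ι × ι => ∫ ω, F q.1 ω * F q.2 ω ∂P) (l ×ˢ l) (𝓝 c)) :
    ∃ L : Ω → ℝ, MemLp L 2 P ∧ Tendsto (fun i => eLpNorm (fun ω => F i ω - L ω) 2 P) l (𝓝 0) := by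
  classical
  let G (i : ι) : Lp ℝ 2 P := if hi : MemLp (F i) 2 P then hi.toLp (F i) else 0
  have hG (i : ι) (hi : MemLp (F i) 2 P) : G i = hi.toLp (F i) := dif_pos hi
  obtain ⟨L, hL⟩ : ∃ L, Tendsto G l (𝓝 L) := by
    refine exists_tendsto_of_tendsto_inner (h.congr' ?_)
    filter_upwards [hF.prod_mk hF] with q hq
    rw [hG _ hq.1, hG _ hq.2, inner_toLp_eq_integral_mul]
  refine ⟨L, Lp.memLp L, ((Lp.tendsto_Lp_iff_tendsto_eLpNorm' _ _).1 hL).congr' ?_⟩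
  filter_upwards [hF] with i hi
  refine eLpNorm_congr_ae ?_
  rw [hG i hi]
  filter_upwards [hi.coeFn_toLp] with ω hω
  rw [Pi.sub_apply, hω]

end MeanSquareLimits

section Criterion

variable {N d : ℕ} {Ω Ω₀ : Type*} [MeasurableSpace Ω] [MeasurableSpace Ω₀]
  {P : Measure Ω} [IsFiniteMeasure P] {P₀ : Measure Ω₀}
  {X₀ : unitCube N → Ω₀ → ℝ} {X : unitCube N → Ω → EuclideanSpace ℝ (Fin d)}
  {x : EuclideanSpace ℝ (Fin d)}

lemma eventually_pos_and_pos :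
    ∀ᶠ q : ℝ × ℝ in 𝓝[>] 0 ×ˢ 𝓝[>] 0, 0 < q.1 ∧ 0 < q.2 :=
  (eventually_mem_nhdsWithin (s := Set.Ioi (0 : ℝ))).prod_mk eventually_mem_nhdsWithin

lemma exists_isLocalTime_of_integrable_covDet_rpow [IsProbabilityMeasure P₀]
    (hX₀ : IsCenteredGaussianField X₀ P₀) (hXmeas : Measurable (Function.uncurry X))
    (hX : CoordsIndepCopies X P X₀ P₀) (x : EuclideanSpace ℝ (Fin d))
    (hpos : ∀ᵐ p ∂(lebesgueCube N).prod (lebesgueCube N), 0 < covDet (X₀ p.1) (X₀ p.2) P₀)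
    (hint : Integrable (fun p => covDet (X₀ p.1) (X₀ p.2) P₀ ^ (-((d : ℝ) / 2)))
      ((lebesgueCube N).prod (lebesgueCube N))) :
    ∃ L, IsLocalTime X P x L := by
  have hlim : Tendsto (fun q : ℝ × ℝ => ∫ p, twoPointDensity X₀ P₀ x q.1 q.2 p
      ∂((lebesgueCube N).prod (lebesgueCube N))) (𝓝[>] 0 ×ˢ 𝓝[>] 0)
      (𝓝 (∫ p, twoPointDensity X₀ P₀ x 0 0 p ∂((lebesgueCube N).prod (lebesgueCube N)))) := by
    refine tendsto_integral_filter_of_dominated_convergence _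
      (Eventually.of_forall fun q =>
        (hX₀.measurable_twoPointDensity x q.1 q.2).aestronglyMeasurable) ?_ hint ?_
    · filter_upwards [eventually_pos_and_pos] with q hq
      filter_upwards [hpos] with p hp
      rw [Real.norm_of_nonneg (twoPointDensity_nonneg _ _ _)]
      exact twoPointDensity_le hp le_rfl hq.1.le hq.2.le
    · filter_upwards [hpos] with p hp
      exact tendsto_twoPointDensity hp
  refine exists_tendsto_eLpNorm_of_tendsto_integral_mul ?_ (hlim.congr' ?_)
  · filter_upwards [eventually_mem_nhdsWithin] with ε hε
    exact memLp_approxLocalTime hXmeas x hε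
  · filter_upwards [eventually_pos_and_pos] with q hq
    exact (integral_approxLocalTime_mul hX₀ hXmeas hX x hq.1 hq.2).symm

lemma lintegral_twoPointDensity_eq_eLpNorm_sq (hX₀ : IsCenteredGaussianField X₀ P₀)
    (hXmeas : Measurable (Function.uncurry X)) (hX : CoordsIndepCopies X P X₀ P₀)
    (x : EuclideanSpace ℝ (Fin d)) {ε : ℝ} (hε : 0 < ε) :
    ∫⁻ p, ENNReal.ofReal (twoPointDensity X₀ P₀ x ε ε p)
      ∂((lebesgueCube N).prod (lebesgueCube N)) = eLpNorm (approxLocalTime X x ε) 2 P ^ 2 := by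
  have hint : Integrable (twoPointDensity X₀ P₀ x ε ε)
      ((lebesgueCube N).prod (lebesgueCube N)) := by
    refine (integrable_heatKernel_mul_heatKernel (P := P) hXmeas x hε hε).integral_prod_right.congr
      (ae_of_all _ fun p => ?_)
    exact integral_heatKernel_mul_heatKernel hX₀ hXmeas hX x hε hε p.1 p.2
  rw [← ofReal_integral_mul_self_eq_eLpNorm_sq (memLp_approxLocalTime hXmeas x hε),
    integral_approxLocalTime_mul hX₀ hXmeas hX x hε hε, ofReal_integral_eq_lintegral_ofReal hint
    (ae_of_all _ fun p => twoPointDensity_nonneg _ _ p)]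

lemma lintegral_twoPointDensity_zero_le_liminf [IsProbabilityMeasure P₀]
    (hX₀ : IsCenteredGaussianField X₀ P₀)
    (hpos : ∀ᵐ p ∂(lebesgueCube N).prod (lebesgueCube N), 0 < covDet (X₀ p.1) (X₀ p.2) P₀) :
    ∫⁻ p, ENNReal.ofReal (twoPointDensity X₀ P₀ x 0 0 p)
      ∂((lebesgueCube N).prod (lebesgueCube N)) ≤
      liminf (fun ε => ∫⁻ p, ENNReal.ofReal (twoPointDensity X₀ P₀ x ε ε p)
        ∂((lebesgueCube N).prod (lebesgueCube N))) (𝓝[>] 0) := by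
  calc ∫⁻ p, ENNReal.ofReal (twoPointDensity X₀ P₀ x 0 0 p)
        ∂((lebesgueCube N).prod (lebesgueCube N))
      = ∫⁻ p, liminf (fun ε => ENNReal.ofReal (twoPointDensity X₀ P₀ x ε ε p)) (𝓝[>] 0)
          ∂((lebesgueCube N).prod (lebesgueCube N)) := by
        refine lintegral_congr_ae ?_
        filter_upwards [hpos] with p hp
        exact (ENNReal.tendsto_ofReal ((tendsto_twoPointDensity hp).comp
          (tendsto_id.prodMk tendsto_id))).liminf_eq.symm
    _ ≤ _ := lintegral_liminf_le fun ε => (hX₀.measurable_twoPointDensity x ε ε).ennreal_ofReal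

lemma IsLocalTime.lintegral_twoPointDensity_le [IsProbabilityMeasure P₀] {L : Ω → ℝ}
    (hL : IsLocalTime X P x L) (hX₀ : IsCenteredGaussianField X₀ P₀)
    (hXmeas : Measurable (Function.uncurry X)) (hX : CoordsIndepCopies X P X₀ P₀)
    (hpos : ∀ᵐ p ∂(lebesgueCube N).prod (lebesgueCube N), 0 < covDet (X₀ p.1) (X₀ p.2) P₀) :
    ∫⁻ p, ENNReal.ofReal (twoPointDensity X₀ P₀ x 0 0 p)
      ∂((lebesgueCube N).prod (lebesgueCube N)) ≤ eLpNorm L 2 P ^ 2 := by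
  have hbound : Tendsto (fun ε => (eLpNorm (fun ω => approxLocalTime X x ε ω - L ω) 2 P +
      eLpNorm L 2 P) ^ 2) (𝓝[>] 0) (𝓝 (eLpNorm L 2 P ^ 2)) := by
    simpa only [zero_add] using ENNReal.Tendsto.pow (n := 2) (hL.2.add_const (eLpNorm L 2 P))
  have hnorm : ∀ᶠ ε in 𝓝[>] 0, eLpNorm (approxLocalTime X x ε) 2 P ^ 2 ≤
      (eLpNorm (fun ω => approxLocalTime X x ε ω - L ω) 2 P + eLpNorm L 2 P) ^ 2 := by
    filter_upwards [eventually_mem_nhdsWithin] with ε hε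
    have htri := eLpNorm_add_le ((memLp_approxLocalTime hXmeas x hε).sub hL.1).aestronglyMeasurable
      hL.1.aestronglyMeasurable one_le_two
    rw [sub_add_cancel] at htri
    exact pow_le_pow_left' htri 2
  calc ∫⁻ p, ENNReal.ofReal (twoPointDensity X₀ P₀ x 0 0 p)
        ∂((lebesgueCube N).prod (lebesgueCube N))
      ≤ liminf (fun ε => ∫⁻ p, ENNReal.ofReal (twoPointDensity X₀ P₀ x ε ε p)
          ∂((lebesgueCube N).prod (lebesgueCube N))) (𝓝[>] 0) :=
        lintegral_twoPointDensity_zero_le_liminf hX₀ hpos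
    _ ≤ liminf (fun ε => (eLpNorm (fun ω => approxLocalTime X x ε ω - L ω) 2 P +
          eLpNorm L 2 P) ^ 2) (𝓝[>] 0) := by
        refine liminf_le_liminf ?_
        filter_upwards [eventually_mem_nhdsWithin, hnorm] with ε hε hεL
        rwa [lintegral_twoPointDensity_eq_eLpNorm_sq hX₀ hXmeas hX x hε]
    _ = eLpNorm L 2 P ^ 2 := hbound.liminf_eq

end Criterion

section UnitSquare

lemma integrableOn_abs_rpow_neg {α : ℝ} (hα : α < 1) {K : Set ℝ} (hK : IsCompact K) :
    IntegrableOn (fun u : ℝ => |u| ^ (-α)) K := by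
  refine LocallyIntegrable.integrableOn_isCompact (locallyIntegrable_of_norm_le_rpow (C := 1)
    (α := α) (by simp) (by simpa using hα) (ae_of_all _ fun u => ?_)
    (by fun_prop : Measurable _).aestronglyMeasurable) hK
  rw [one_mul, Real.norm_eq_abs, Real.norm_eq_abs, abs_of_nonneg (by positivity)]

lemma integrable_abs_rpow_neg_mul_abs_sub_rpow_neg {α : ℝ} (hα : α < 1) :
    Integrable (fun q : ℝ × ℝ => |q.1| ^ (-α) * |q.1 - q.2| ^ (-α))
      (((volume : Measure ℝ).restrict (Set.Icc 0 1)).prod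
        ((volume : Measure ℝ).restrict (Set.Icc 0 1))) := by
  have hprod : Integrable (fun q : ℝ × ℝ =>
      (Set.Icc (0 : ℝ) 1).indicator (fun u => |u| ^ (-α)) q.1 *
        (Set.Icc (-1 : ℝ) 1).indicator (fun u => |u| ^ (-α)) q.2) (volume.prod volume) :=
    ((integrableOn_abs_rpow_neg hα isCompact_Icc).integrable_indicator measurableSet_Icc).mul_prod
      ((integrableOn_abs_rpow_neg hα isCompact_Icc).integrable_indicator measurableSet_Icc)
  rw [Measure.prod_restrict]
  refine (((measurePreserving_prod_sub (volume : Measure ℝ)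
    (volume : Measure ℝ)).integrable_comp_of_integrable hprod).integrableOn
    (s := Set.Icc 0 1 ×ˢ Set.Icc 0 1)).congr_fun ?_ (measurableSet_Icc.prod measurableSet_Icc)
  rintro ⟨a, b⟩ ⟨ha, hb⟩
  have hab : b - a ∈ Set.Icc (-1 : ℝ) 1 := ⟨by linarith [ha.2, hb.1], by linarith [ha.1, hb.2]⟩
  simp only [Function.comp_apply]
  rw [Set.indicator_of_mem ha, Set.indicator_of_mem hab, abs_sub_comm]

lemma integrable_mul_min_abs_sub_rpow_neg {α : ℝ} (hα : α < 1) :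
    Integrable (fun q : ℝ × ℝ => (q.1 * min |q.1 - q.2| q.2) ^ (-α))
      (((volume : Measure ℝ).restrict (Set.Icc 0 1)).prod
        ((volume : Measure ℝ).restrict (Set.Icc 0 1))) := by
  have hIcc := integrableOn_abs_rpow_neg hα (isCompact_Icc (a := (0 : ℝ)) (b := 1))
  refine ((integrable_abs_rpow_neg_mul_abs_sub_rpow_neg hα).add (hIcc.mul_prod hIcc)).mono'
    (by fun_prop : Measurable _).aestronglyMeasurable ?_
  rw [Measure.prod_restrict]
  filter_upwards [ae_restrict_mem (measurableSet_Icc.prod measurableSet_Icc)] with q hq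
  have hmin : 0 ≤ min |q.1 - q.2| q.2 := le_min (abs_nonneg _) hq.2.1
  rw [Real.norm_of_nonneg (Real.rpow_nonneg (mul_nonneg hq.1.1 hmin) _),
    Real.mul_rpow hq.1.1 hmin, Pi.add_apply, ← mul_add, abs_of_nonneg hq.1.1, abs_of_nonneg hq.2.1]
  refine mul_le_mul_of_nonneg_left ?_ (Real.rpow_nonneg hq.1.1 _)
  rcases min_choice |q.1 - q.2| q.2 with h | h <;> rw [h]
  · exact le_add_of_nonneg_right (Real.rpow_nonneg hq.2.1 _)
  · exact le_add_of_nonneg_left (Real.rpow_nonneg (abs_nonneg _) _)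

lemma ae_mul_min_abs_sub_pos :
    ∀ᵐ q : ℝ × ℝ ∂((volume : Measure ℝ).restrict (Set.Icc 0 1)).prod
      ((volume : Measure ℝ).restrict (Set.Icc 0 1)), 0 < q.1 * min |q.1 - q.2| q.2 := by
  have hpos : ∀ᵐ u : ℝ ∂(volume : Measure ℝ).restrict (Set.Icc 0 1), 0 < u := by
    filter_upwards [Measure.ae_ne _ 0, ae_restrict_mem measurableSet_Icc] with u hu hmem
    exact hmem.1.lt_of_ne' hu
  rw [Measure.ae_prod_iff_ae_ae (measurableSet_lt (by fun_prop) (by fun_prop))]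
  filter_upwards [hpos] with a ha
  filter_upwards [hpos, Measure.ae_ne _ a] with b hb hab
  exact mul_pos ha (lt_min (abs_pos.2 (sub_ne_zero.2 hab.symm)) hb)

end UnitSquare

section Sufficiency

lemma prod_rpow_div_le_sum_rpow {ι : Type*} [Fintype ι] [Nonempty ι] {H : ι → ℝ}
    (hH : ∀ j, 0 < H j) {u : ι → ℝ} (hu : ∀ j, 0 ≤ u j) (a : ℝ) :
    ∏ j, u j ^ (a / ∑ k, 1 / H k) ≤ ∑ j, u j ^ (a * H j) := by
  have hQ : 0 < ∑ k, 1 / H k :=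
    Finset.sum_pos (fun j _ => one_div_pos.2 (hH j)) Finset.univ_nonempty
  have hw (j : ι) : 0 ≤ (1 / H j) / ∑ k, 1 / H k := div_nonneg (one_div_pos.2 (hH j)).le hQ.le
  have hsum : ∑ j, (1 / H j) / ∑ k, 1 / H k = 1 := by rw [← Finset.sum_div, div_self hQ.ne']
  calc ∏ j, u j ^ (a / ∑ k, 1 / H k)
      = ∏ j, (u j ^ (a * H j)) ^ ((1 / H j) / ∑ k, 1 / H k) := by
        refine Finset.prod_congr rfl fun j _ => ?_
        rw [← Real.rpow_mul (hu j)]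
        have := (hH j).ne'
        congr 1
        field_simp
    _ ≤ ∑ j, (1 / H j) / (∑ k, 1 / H k) * u j ^ (a * H j) :=
        Real.geom_mean_le_arith_mean_weighted _ _ _ (fun j _ => hw j) hsum
          fun j _ => Real.rpow_nonneg (hu j) _
    _ ≤ ∑ j, u j ^ (a * H j) :=
        Finset.sum_le_sum fun j hj => mul_le_of_le_one_left (Real.rpow_nonneg (hu j) _)
          ((Finset.single_le_sum (fun j _ => hw j) hj).trans hsum.le)

variable {N d : ℕ} {Ω₀ : Type*} [MeasurableSpace Ω₀] {P₀ : Measure Ω₀} [IsProbabilityMeasure P₀]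
  {X₀ : unitCube N → Ω₀ → ℝ} {H : Fin N → ℝ}

lemma CondC2.exists_variance_ge_and_covDet_ge (hC2 : CondC2 X₀ P₀ H)
    (hX₀ : IsCenteredGaussianField X₀ P₀) (hH : ∀ j, 0 < H j) :
    ∃ c : ℝ, 0 < c ∧ (∀ t : unitCube N, c * ∑ j, t.1 j ^ (2 * H j) ≤ Var[X₀ t; P₀]) ∧
      ∀ s t : unitCube N, Var[X₀ s; P₀] * (c * ∑ j, min |s.1 j - t.1 j| (t.1 j) ^ (2 * H j)) ≤
        covDet (X₀ s) (X₀ t) P₀ := by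
  obtain ⟨c, hc, hcondVar⟩ := hC2
  have hmin (s t : unitCube N) : ∀ᵐ ω ∂P₀,
      c * ∑ j, min |s.1 j - t.1 j| (t.1 j) ^ (2 * H j) ≤
        condVar (MeasurableSpace.comap (X₀ s) inferInstance) (X₀ t) P₀ ω := by
    filter_upwards [hcondVar s t] with ω hω
    refine le_trans (mul_le_mul_of_nonneg_left (Finset.sum_le_sum fun j _ => ?_) hc.le) hω
    have hmono : MonotoneOn (fun u : ℝ => u ^ (2 * H j)) (Set.Ici 0) := fun a ha b _ hab =>
      Real.rpow_le_rpow ha hab (mul_pos two_pos (hH j)).le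
    rw [abs_of_nonneg (t.2.1 j)]
    exact (hmono.map_min (Set.mem_Ici.2 (abs_nonneg _)) (Set.mem_Ici.2 (t.2.1 j))).le
  refine ⟨c, hc, fun t => ?_, fun s t => variance_mul_le_covDet_of_le_condVar (hX₀.measurable s)
    (hX₀.memLp_two s) (hX₀.memLp_two t) (hmin s t)⟩
  have hzero := le_variance_of_le_condVar (hX₀.measurable _).comap_le (hX₀.memLp_two t)
    (hmin ⟨0, by simp⟩ t)
  simpa only [Pi.zero_apply, zero_sub, abs_neg, abs_of_nonneg (t.2.1 _), min_self] using hzero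

lemma CondC2.exists_prod_rpow_le_covDet (hC2 : CondC2 X₀ P₀ H)
    (hX₀ : IsCenteredGaussianField X₀ P₀) (hN : 0 < N) (hH : ∀ j, 0 < H j) :
    ∃ c : ℝ, 0 < c ∧ ∀ s t : unitCube N,
      c * ∏ j, (s.1 j * min |s.1 j - t.1 j| (t.1 j)) ^ (2 / ∑ k, 1 / H k) ≤
        covDet (X₀ s) (X₀ t) P₀ := by
  have : Nonempty (Fin N) := ⟨⟨0, hN⟩⟩
  obtain ⟨c, hc, hvar, hdet⟩ := hC2.exists_variance_ge_and_covDet_ge hX₀ hH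
  refine ⟨c * c, mul_pos hc hc, fun s t => le_trans ?_ (hdet s t)⟩
  have hmin (j : Fin N) : 0 ≤ min |s.1 j - t.1 j| (t.1 j) := le_min (abs_nonneg _) (t.2.1 j)
  simp only [Real.mul_rpow (s.2.1 _) (hmin _), Finset.prod_mul_distrib]
  rw [mul_mul_mul_comm]
  gcongr
  · exact mul_nonneg hc.le (Finset.prod_nonneg fun j _ => Real.rpow_nonneg (hmin j) _)
  · exact variance_nonneg _ _
  · exact (mul_le_mul_of_nonneg_left (prod_rpow_div_le_sum_rpow hH s.2.1 2) hc.le).trans (hvar s)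
  · exact prod_rpow_div_le_sum_rpow hH hmin 2

lemma ae_forall_mul_min_abs_sub_pos (N : ℕ) :
    ∀ᵐ p : unitCube N × unitCube N ∂(lebesgueCube N).prod (lebesgueCube N),
      ∀ j, 0 < p.1.1 j * min |p.1.1 j - p.2.1 j| (p.2.1 j) := by
  refine (measurePreserving_coords_lebesgueCube N).quasiMeasurePreserving.ae
    (p := fun f => ∀ j, 0 < (f j).1 * min |(f j).1 - (f j).2| (f j).2) ?_
  exact ae_all_iff.2 fun j => (Measure.quasiMeasurePreserving_eval
    (μ := fun _ : Fin N => ((volume : Measure ℝ).restrict (Set.Icc 0 1)).prod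
      ((volume : Measure ℝ).restrict (Set.Icc 0 1))) j).ae ae_mul_min_abs_sub_pos

lemma CondC2.ae_covDet_pos (hC2 : CondC2 X₀ P₀ H) (hX₀ : IsCenteredGaussianField X₀ P₀)
    (hN : 0 < N) (hH : ∀ j, 0 < H j) :
    ∀ᵐ p ∂(lebesgueCube N).prod (lebesgueCube N), 0 < covDet (X₀ p.1) (X₀ p.2) P₀ := by
  obtain ⟨c, hc, hdet⟩ := hC2.exists_prod_rpow_le_covDet hX₀ hN hH
  filter_upwards [ae_forall_mul_min_abs_sub_pos N] with p hp
  exact (mul_pos hc (Finset.prod_pos fun j _ => Real.rpow_pos_of_pos (hp j) _)).trans_le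
    (hdet p.1 p.2)

lemma CondC2.integrable_covDet_rpow (hC2 : CondC2 X₀ P₀ H) (hX₀ : IsCenteredGaussianField X₀ P₀)
    (hN : 0 < N) (hH : ∀ j, 0 < H j) {r : ℝ} (hr : 0 ≤ r) (hrH : 2 * r < ∑ j, 1 / H j) :
    Integrable (fun p => covDet (X₀ p.1) (X₀ p.2) P₀ ^ (-r))
      ((lebesgueCube N).prod (lebesgueCube N)) := by
  obtain ⟨c, hc, hdet⟩ := hC2.exists_prod_rpow_le_covDet hX₀ hN hH
  have hα : 2 * r / ∑ k, 1 / H k < 1 := (div_lt_one (by linarith)).2 hrH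
  have hint : Integrable (fun p : unitCube N × unitCube N => ∏ j,
      (p.1.1 j * min |p.1.1 j - p.2.1 j| (p.2.1 j)) ^ (-(2 * r / ∑ k, 1 / H k)))
      ((lebesgueCube N).prod (lebesgueCube N)) :=
    (measurePreserving_coords_lebesgueCube N).integrable_comp_of_integrable
      (Integrable.fintype_prod fun _ => integrable_mul_min_abs_sub_rpow_neg hα)
  refine (hint.const_mul (c ^ (-r))).mono'
    (hX₀.measurable_covDet.pow_const _).aestronglyMeasurable ?_
  filter_upwards [ae_forall_mul_min_abs_sub_pos N] with p hp
  have hprod := Finset.prod_pos fun j (_ : j ∈ Finset.univ) =>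
    Real.rpow_pos_of_pos (hp j) (2 / ∑ k, 1 / H k)
  rw [Real.norm_of_nonneg
    (Real.rpow_nonneg (covDet_nonneg (hX₀.memLp_two p.1) (hX₀.memLp_two p.2)) _)]
  calc covDet (X₀ p.1) (X₀ p.2) P₀ ^ (-r)
      ≤ (c * ∏ j, (p.1.1 j * min |p.1.1 j - p.2.1 j| (p.2.1 j)) ^ (2 / ∑ k, 1 / H k)) ^ (-r) :=
        Real.rpow_le_rpow_of_nonpos (mul_pos hc hprod) (hdet p.1 p.2) (neg_nonpos.2 hr)
    _ = c ^ (-r) * ∏ j, (p.1.1 j * min |p.1.1 j - p.2.1 j| (p.2.1 j)) ^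
          (-(2 * r / ∑ k, 1 / H k)) := by
        rw [Real.mul_rpow hc.le hprod.le,
          ← Real.finsetProd_rpow _ _ fun j _ => Real.rpow_nonneg (hp j).le _]
        congr 1
        refine Finset.prod_congr rfl fun j _ => ?_
        rw [← Real.rpow_mul (hp j).le]
        congr 1
        ring

end Sufficiency

section DiagonalStrip

lemma lintegral_eq_top_of_le_setLIntegral {α ι : Type*} [MeasurableSpace α] {μ : Measure α}
    {l : Filter ι} [l.NeBot] {f : α → ENNReal} {A : ι → Set α} {c : ENNReal} (hc : c ≠ 0)
    (hA : Tendsto (fun i => μ (A i)) l (𝓝 0)) (hf : ∀ᶠ i in l, c ≤ ∫⁻ x in A i, f x ∂μ) :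
    ∫⁻ x, f x ∂μ = ⊤ := by
  by_contra hfin
  exact hc (le_zero_iff.1 (ge_of_tendsto (tendsto_setLIntegral_zero hfin hA) hf))

lemma measure_regionBetween_id_add_const {h : ℝ} (h0 : 0 ≤ h) (h4 : h ≤ 1 / 4) :
    ((volume : Measure ℝ).restrict (Set.Icc 0 1)).prod ((volume : Measure ℝ).restrict (Set.Icc 0 1))
      (regionBetween id (· + h) (Set.Icc (1 / 2) (3 / 4))) = ENNReal.ofReal (h / 4) := by
  have hsub : regionBetween id (· + h) (Set.Icc (1 / 2) (3 / 4)) ⊆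
      Set.Icc (0 : ℝ) 1 ×ˢ Set.Icc (0 : ℝ) 1 := by
    rintro ⟨a, b⟩ ⟨⟨ha, ha'⟩, hb, hb'⟩
    simp only [id_eq] at ha ha' hb hb'
    constructor <;> constructor <;> linarith
  rw [Measure.prod_restrict, Measure.restrict_eq_self _ hsub, volume_regionBetween_eq_integral
    continuous_id.continuousOn.integrableOn_Icc (by fun_prop : Continuous fun u : ℝ =>
      u + h).continuousOn.integrableOn_Icc measurableSet_Icc fun u _ => le_add_of_nonneg_right h0]
  simp only [Pi.sub_apply, id_eq, add_sub_cancel_left, setIntegral_const, smul_eq_mul,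
    Real.volume_real_Icc_of_le (show (1 / 2 : ℝ) ≤ 3 / 4 by norm_num)]
  congr 1
  ring

variable {N : ℕ} {H : Fin N → ℝ} {r : ℝ} {p : unitCube N × unitCube N}

/-- The pairs `(s, t)` near the diagonal with `s` in `[1/2, 3/4]^N` and
`0 < tⱼ - sⱼ < r ^ (1 / (2 Hⱼ)) / 4` for all `j`. The widths are adapted to the anisotropy of the
field: `|sⱼ - tⱼ| ^ (2 Hⱼ) ≤ r` in every direction, and the measure is of order
`r ^ ((∑ j, 1 / Hⱼ) / 2)`. -/
def diagonalStrip (H : Fin N → ℝ) (r : ℝ) : Set (unitCube N × unitCube N) :=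
  {p | ∀ j, p.1.1 j ∈ Set.Icc (1 / 2) (3 / 4) ∧
    p.2.1 j ∈ Set.Ioo (p.1.1 j) (p.1.1 j + r ^ (1 / (2 * H j)) / 4)}

lemma diagonalStrip_eq_preimage (H : Fin N → ℝ) (r : ℝ) :
    diagonalStrip H r = (fun (p : unitCube N × unitCube N) (j : Fin N) => (p.1.1 j, p.2.1 j)) ⁻¹'
      Set.univ.pi fun j => regionBetween id (· + r ^ (1 / (2 * H j)) / 4)
        (Set.Icc (1 / 2) (3 / 4)) := by
  ext p
  simp [diagonalStrip, regionBetween]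

lemma measurableSet_pi_regionBetween (H : Fin N → ℝ) (r : ℝ) :
    MeasurableSet (Set.univ.pi fun j => regionBetween id (· + r ^ (1 / (2 * H j)) / 4)
      (Set.Icc (1 / 2) (3 / 4))) :=
  MeasurableSet.univ_pi fun _ =>
    measurableSet_regionBetween measurable_id (measurable_id.add_const _) measurableSet_Icc

lemma measurableSet_diagonalStrip (H : Fin N → ℝ) (r : ℝ) : MeasurableSet (diagonalStrip H r) := by
  rw [diagonalStrip_eq_preimage]
  exact (measurePreserving_coords_lebesgueCube N).measurable (measurableSet_pi_regionBetween H r)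

lemma measure_diagonalStrip (hH : ∀ j, 0 < H j) (hr : r ∈ Set.Ioc 0 1) :
    (lebesgueCube N).prod (lebesgueCube N) (diagonalStrip H r) =
      ENNReal.ofReal ((1 / 16) ^ N * r ^ ((∑ j, 1 / H j) / 2)) := by
  have hwidth (j : Fin N) : r ^ (1 / (2 * H j)) ≤ 1 :=
    Real.rpow_le_one hr.1.le hr.2 (one_div_nonneg.2 (mul_pos two_pos (hH j)).le)
  rw [diagonalStrip_eq_preimage, (measurePreserving_coords_lebesgueCube N).measure_preimage
    (measurableSet_pi_regionBetween H r).nullMeasurableSet, Measure.pi_pi]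
  calc ∏ j, ((volume : Measure ℝ).restrict (Set.Icc 0 1)).prod
        ((volume : Measure ℝ).restrict (Set.Icc 0 1))
        (regionBetween id (· + r ^ (1 / (2 * H j)) / 4) (Set.Icc (1 / 2) (3 / 4)))
      = ∏ j, ENNReal.ofReal (1 / 16 * r ^ (1 / (2 * H j))) :=
        Finset.prod_congr rfl fun j _ => by
          rw [measure_regionBetween_id_add_const (div_nonneg (Real.rpow_nonneg hr.1.le _) (by simp))
            (div_le_div_of_nonneg_right (hwidth j) (by simp))]
          ring_nf
    _ = ENNReal.ofReal (∏ j, (1 / 16 * r ^ (1 / (2 * H j)))) :=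
        (ENNReal.ofReal_prod_of_nonneg fun j _ =>
          mul_nonneg (by simp) (Real.rpow_nonneg hr.1.le _)).symm
    _ = ENNReal.ofReal ((1 / 16) ^ N * r ^ ((∑ j, 1 / H j) / 2)) := by
        rw [Finset.prod_mul_distrib, Finset.prod_const, Finset.card_univ, Fintype.card_fin,
          ← Real.rpow_sum_of_pos hr.1, Finset.sum_div]
        congr! 4 with j
        ring

lemma tendsto_measure_diagonalStrip (hN : 0 < N) (hH : ∀ j, 0 < H j) :
    Tendsto (fun r => (lebesgueCube N).prod (lebesgueCube N) (diagonalStrip H r))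
      (𝓝[>] 0) (𝓝 0) := by
  have hQ : 0 < (∑ j, 1 / H j) / 2 :=
    half_pos (Finset.sum_pos (fun j _ => one_div_pos.2 (hH j)) ⟨⟨0, hN⟩, Finset.mem_univ _⟩)
  have hlim : Tendsto (fun r : ℝ => ENNReal.ofReal ((1 / 16) ^ N * r ^ ((∑ j, 1 / H j) / 2)))
      (𝓝[>] 0) (𝓝 0) := by
    have hrpow := (Real.continuousAt_rpow_const 0 _ (.inr hQ.le)).tendsto
    simpa only [Real.zero_rpow hQ.ne', mul_zero, ENNReal.ofReal_zero] using
      ENNReal.tendsto_ofReal ((hrpow.const_mul ((1 / 16) ^ N)).mono_left nhdsWithin_le_nhds)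
  refine hlim.congr' ?_
  filter_upwards [Ioc_mem_nhdsGT one_pos] with r hr
  exact (measure_diagonalStrip hH hr).symm

lemma sum_abs_sub_rpow_le_of_mem_diagonalStrip (hH : ∀ j, 0 < H j) (hr : 0 ≤ r)
    (hp : p ∈ diagonalStrip H r) : ∑ j, |p.1.1 j - p.2.1 j| ^ (2 * H j) ≤ N * r := by
  have hterm (j : Fin N) : |p.1.1 j - p.2.1 j| ^ (2 * H j) ≤ r := by
    have hHj : 0 < 2 * H j := mul_pos two_pos (hH j)
    have hdist : |p.1.1 j - p.2.1 j| ≤ r ^ (1 / (2 * H j)) := by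
      rw [abs_sub_comm, abs_of_pos (sub_pos.2 (hp j).2.1)]
      linarith [(hp j).2.2, Real.rpow_nonneg hr (1 / (2 * H j))]
    calc |p.1.1 j - p.2.1 j| ^ (2 * H j) ≤ (r ^ (1 / (2 * H j))) ^ (2 * H j) :=
          Real.rpow_le_rpow (abs_nonneg _) hdist hHj.le
      _ = r := by rw [← Real.rpow_mul hr, one_div_mul_cancel hHj.ne', Real.rpow_one]
  simpa using Finset.sum_le_card_nsmul Finset.univ _ _ fun j _ => hterm j

end DiagonalStrip

lemma inv_sqrt_mul_exp_le_bivariateGaussianPDF_self {A b C k : ℝ} (hD : 0 < A * C - b ^ 2)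
    (hk : A + C - 2 * b ≤ k * (A * C - b ^ 2)) (x : ℝ) :
    (2 * Real.pi * √(A * C - b ^ 2))⁻¹ * Real.exp (-(k * x ^ 2 / 2)) ≤
      bivariateGaussianPDF A b C x x := by
  unfold bivariateGaussianPDF
  refine mul_le_mul_of_nonneg_left (Real.exp_le_exp.2 (neg_le_neg ?_)) (by positivity)
  rw [div_le_div_iff₀ (by linarith) two_pos]
  nlinarith [mul_le_mul_of_nonneg_right hk (sq_nonneg x)]

section Necessity

variable {N d : ℕ} {Ω₀ : Type*} [MeasurableSpace Ω₀] {P₀ : Measure Ω₀} [IsProbabilityMeasure P₀]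
  {X₀ : unitCube N → Ω₀ → ℝ} {H : Fin N → ℝ}

lemma IsCenteredGaussianField.mul_covDet_rpow_le_twoPointDensity
    (hX₀ : IsCenteredGaussianField X₀ P₀) {p : unitCube N × unitCube N}
    (hp : 0 < covDet (X₀ p.1) (X₀ p.2) P₀) {k : ℝ}
    (hk : Var[X₀ p.1 - X₀ p.2; P₀] ≤ k * covDet (X₀ p.1) (X₀ p.2) P₀)
    (x : EuclideanSpace ℝ (Fin d)) :
    (∏ i, (2 * Real.pi)⁻¹ * Real.exp (-(k * x i ^ 2 / 2))) *
      covDet (X₀ p.1) (X₀ p.2) P₀ ^ (-((d : ℝ) / 2)) ≤ twoPointDensity X₀ P₀ x 0 0 p := by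
  have hpow : covDet (X₀ p.1) (X₀ p.2) P₀ ^ (-((d : ℝ) / 2)) =
      ∏ _ : Fin d, (√(covDet (X₀ p.1) (X₀ p.2) P₀))⁻¹ := by
    rw [Finset.prod_const, Finset.card_univ, Fintype.card_fin, Real.sqrt_eq_rpow,
      ← Real.rpow_neg hp.le, ← Real.rpow_natCast, ← Real.rpow_mul hp.le]
    congr 1
    ring
  rw [variance_sub (hX₀.memLp_two _) (hX₀.memLp_two _)] at hk
  rw [hpow, ← Finset.prod_mul_distrib, twoPointDensity]
  refine Finset.prod_le_prod (fun i _ => by positivity) fun i _ => ?_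
  rw [add_zero, add_zero, mul_right_comm, ← mul_inv]
  exact inv_sqrt_mul_exp_le_bivariateGaussianPDF_self hp (by unfold covDet at hk; linarith) _

lemma CondC1.exists_variance_sub_le (hC1 : CondC1 X₀ P₀ H) (hX₀ : IsCenteredGaussianField X₀ P₀) :
    ∃ c : ℝ, 0 < c ∧ ∀ s t : unitCube N,
      Var[X₀ s - X₀ t; P₀] ≤ c * ∑ j, |s.1 j - t.1 j| ^ (2 * H j) := by
  obtain ⟨c, hc, hle⟩ := hC1
  exact ⟨c, hc, fun s t => (variance_le_expectation_sq
    ((hX₀.measurable s).sub (hX₀.measurable t)).aestronglyMeasurable).trans (hle s t)⟩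

lemma IsCenteredGaussianField.exists_variance_le (hX₀ : IsCenteredGaussianField X₀ P₀) :
    ∃ K : ℝ, 0 < K ∧ ∀ t : unitCube N, Var[X₀ t; P₀] ≤ K := by
  obtain ⟨K, hK⟩ := (isCompact_range hX₀.continuous_variance).bddAbove
  exact ⟨max K 1, by positivity, fun t => (hK (Set.mem_range_self t)).trans (le_max_left _ _)⟩

lemma CondC2.exists_sum_rpow_le_covDet_of_mem_diagonalStrip (hC2 : CondC2 X₀ P₀ H)
    (hX₀ : IsCenteredGaussianField X₀ P₀) (hN : 0 < N) (hH : ∀ j, 0 < H j) :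
    ∃ c : ℝ, 0 < c ∧ ∀ r : ℝ, ∀ p ∈ diagonalStrip H r,
      c * ∑ j, |p.1.1 j - p.2.1 j| ^ (2 * H j) ≤ covDet (X₀ p.1) (X₀ p.2) P₀ := by
  have : Nonempty (Fin N) := ⟨⟨0, hN⟩⟩
  obtain ⟨c, hc, hvar, hdet⟩ := hC2.exists_variance_ge_and_covDet_ge hX₀ hH
  have : 0 < ∑ j, (1 / 2 : ℝ) ^ (2 * H j) :=
    Finset.sum_pos (fun j _ => by positivity) Finset.univ_nonempty
  refine ⟨c * (∑ j, (1 / 2 : ℝ) ^ (2 * H j)) * c, by positivity, fun r p hp => ?_⟩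
  have hvar' : c * ∑ j, (1 / 2 : ℝ) ^ (2 * H j) ≤ Var[X₀ p.1; P₀] := by
    refine (mul_le_mul_of_nonneg_left (Finset.sum_le_sum fun j _ => ?_) hc.le).trans (hvar p.1)
    exact Real.rpow_le_rpow (by simp) (hp j).1.1 (mul_pos two_pos (hH j)).le
  have hmin (j : Fin N) : min |p.1.1 j - p.2.1 j| (p.2.1 j) = |p.1.1 j - p.2.1 j| := by
    rw [abs_sub_comm, abs_of_pos (sub_pos.2 (hp j).2.1)]
    exact min_eq_left (sub_le_self _ (p.1.2.1 j))
  have hdet' := hdet p.1 p.2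
  simp only [hmin] at hdet'
  rw [mul_assoc]
  exact (mul_le_mul_of_nonneg_right hvar' (by positivity)).trans hdet'

lemma exists_mul_rpow_le_twoPointDensity_of_mem_diagonalStrip
    (hX₀ : IsCenteredGaussianField X₀ P₀) (hN : 0 < N) (hH : ∀ j, 0 < H j)
    (hC1 : CondC1 X₀ P₀ H) (hC2 : CondC2 X₀ P₀ H) (x : EuclideanSpace ℝ (Fin d)) :
    ∃ κ : ℝ, 0 < κ ∧ ∀ r : ℝ, 0 < r → ∀ p ∈ diagonalStrip H r,
      κ * r ^ (-((d : ℝ) / 2)) ≤ twoPointDensity X₀ P₀ x 0 0 p := by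
  have : Nonempty (Fin N) := ⟨⟨0, hN⟩⟩
  obtain ⟨c₁, hc₁, hinc⟩ := hC1.exists_variance_sub_le hX₀
  obtain ⟨c₂, hc₂, hdet⟩ := hC2.exists_sum_rpow_le_covDet_of_mem_diagonalStrip hX₀ hN hH
  obtain ⟨K, hK, hvar⟩ := hX₀.exists_variance_le
  refine ⟨(∏ i, (2 * Real.pi)⁻¹ * Real.exp (-(c₁ / c₂ * x i ^ 2 / 2))) *
    (K * (c₁ * N)) ^ (-((d : ℝ) / 2)), by positivity, fun r hr p hp => ?_⟩
  have hσ : 0 < ∑ j, |p.1.1 j - p.2.1 j| ^ (2 * H j) := Finset.sum_pos (fun j _ =>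
    Real.rpow_pos_of_pos (abs_pos.2 (sub_neg.2 (hp j).2.1).ne) _) Finset.univ_nonempty
  have hpos : 0 < covDet (X₀ p.1) (X₀ p.2) P₀ := (mul_pos hc₂ hσ).trans_le (hdet r p hp)
  have hle : covDet (X₀ p.1) (X₀ p.2) P₀ ≤ K * (c₁ * N) * r := by
    refine (covDet_le_variance_mul_variance_sub (hX₀.memLp_two _) (hX₀.memLp_two _)).trans ?_
    rw [mul_assoc, mul_assoc]
    refine mul_le_mul (hvar _) ((hinc _ _).trans ?_) (variance_nonneg _ _) hK.le
    exact mul_le_mul_of_nonneg_left (sum_abs_sub_rpow_le_of_mem_diagonalStrip hH hr.le hp) hc₁.le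
  have hinc' : Var[X₀ p.1 - X₀ p.2; P₀] ≤ c₁ / c₂ * covDet (X₀ p.1) (X₀ p.2) P₀ := by
    refine (hinc p.1 p.2).trans ?_
    rw [div_mul_eq_mul_div, le_div_iff₀ hc₂, mul_assoc, mul_comm _ c₂]
    exact mul_le_mul_of_nonneg_left (hdet r p hp) hc₁.le
  refine le_trans ?_ (hX₀.mul_covDet_rpow_le_twoPointDensity hpos hinc' x)
  rw [mul_assoc, ← Real.mul_rpow (by positivity) hr.le]
  exact mul_le_mul_of_nonneg_left (Real.rpow_le_rpow_of_nonpos hpos hle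
    (neg_nonpos.2 (by positivity))) (by positivity)

lemma lintegral_twoPointDensity_eq_top (hX₀ : IsCenteredGaussianField X₀ P₀) (hN : 0 < N)
    (hH : ∀ j, 0 < H j) (hC1 : CondC1 X₀ P₀ H) (hC2 : CondC2 X₀ P₀ H)
    (x : EuclideanSpace ℝ (Fin d)) (hd : ∑ j, 1 / H j ≤ d) :
    ∫⁻ p, ENNReal.ofReal (twoPointDensity X₀ P₀ x 0 0 p)
      ∂((lebesgueCube N).prod (lebesgueCube N)) = ⊤ := by
  obtain ⟨κ, hκ, hdensity⟩ :=
    exists_mul_rpow_le_twoPointDensity_of_mem_diagonalStrip hX₀ hN hH hC1 hC2 x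
  refine lintegral_eq_top_of_le_setLIntegral (c := ENNReal.ofReal (κ * (1 / 16) ^ N))
    (ENNReal.ofReal_pos.2 (by positivity)).ne' (tendsto_measure_diagonalStrip hN hH) ?_
  filter_upwards [Ioc_mem_nhdsGT one_pos] with r ⟨hr0, hr1⟩
  calc ENNReal.ofReal (κ * (1 / 16) ^ N)
      ≤ ENNReal.ofReal (κ * (1 / 16) ^ N * r ^ (((∑ j, 1 / H j) - d) / 2)) :=
        ENNReal.ofReal_le_ofReal (le_mul_of_one_le_right (by positivity)
          (Real.one_le_rpow_of_pos_of_le_one_of_nonpos hr0 hr1 (by linarith)))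
    _ = ENNReal.ofReal (κ * r ^ (-((d : ℝ) / 2))) *
          (lebesgueCube N).prod (lebesgueCube N) (diagonalStrip H r) := by
        rw [measure_diagonalStrip hH ⟨hr0, hr1⟩, ← ENNReal.ofReal_mul (by positivity),
          mul_mul_mul_comm, ← Real.rpow_add hr0]
        congr! 3
        ring
    _ ≤ ∫⁻ p in diagonalStrip H r, ENNReal.ofReal (twoPointDensity X₀ P₀ x 0 0 p)
          ∂((lebesgueCube N).prod (lebesgueCube N)) := by
        rw [← setLIntegral_const]
        exact setLIntegral_mono' (measurableSet_diagonalStrip H r) fun p hp =>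
          ENNReal.ofReal_le_ofReal (hdensity r hr0 p hp)

end Necessity

theorem mainTheorem2_general {N d : ℕ} (hN : 0 < N) {Ω Ω₀ : Type*}
    [MeasurableSpace Ω] [MeasurableSpace Ω₀]
    (P : Measure Ω) [IsProbabilityMeasure P] (P₀ : Measure Ω₀) [IsProbabilityMeasure P₀]
    (X₀ : unitCube N → Ω₀ → ℝ) (hX₀ : IsCenteredGaussianField X₀ P₀)
    (X : unitCube N → Ω → EuclideanSpace ℝ (Fin d))
    (hXmeas : Measurable (Function.uncurry X))
    (hX : CoordsIndepCopies X P X₀ P₀)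
    (H : Fin N → ℝ) (hH : ∀ j, 0 < H j)
    (hC1 : CondC1 X₀ P₀ H) (hC2 : CondC2 X₀ P₀ H)
    (x : EuclideanSpace ℝ (Fin d)) :
    (∃ L : Ω → ℝ, IsLocalTime X P x L) ↔ (d : ℝ) < ∑ j, 1 / H j := by
  have hpos := hC2.ae_covDet_pos hX₀ hN hH
  constructor
  · rintro ⟨L, hL⟩
    by_contra! hd
    have hfin := hL.lintegral_twoPointDensity_le hX₀ hXmeas hX hpos
    rw [lintegral_twoPointDensity_eq_top hX₀ hN hH hC1 hC2 x hd, top_le_iff] at hfin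
    exact ENNReal.pow_ne_top hL.1.eLpNorm_ne_top hfin
  · intro hd
    exact exists_isLocalTime_of_integrable_covDet_rpow hX₀ hXmeas hX x hpos
      (hC2.integrable_covDet_rpow hX₀ hN hH (by positivity) (by linarith))

end

theorem mainTheorem2 {N d : ℕ} (hN : 0 < N) {Ω Ω₀ : Type*}
    [MeasurableSpace Ω] [MeasurableSpace Ω₀]
    (P : Measure Ω) [IsProbabilityMeasure P] (P₀ : Measure Ω₀) [IsProbabilityMeasure P₀]
    (X₀ : unitCube N → Ω₀ → ℝ) (hX₀ : IsCenteredGaussianField X₀ P₀)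
    (X : unitCube N → Ω → EuclideanSpace ℝ (Fin d))
    (hXmeas : Measurable (Function.uncurry X))
    (hX : CoordsIndepCopies X P X₀ P₀)
    (H : Fin N → ℝ) (hH : ∀ j, H j ∈ Set.Ioo (0 : ℝ) 1)
    (hC1 : CondC1 X₀ P₀ H) (hC2 : CondC2 X₀ P₀ H)
    (x : EuclideanSpace ℝ (Fin d)) :
    (∃ L : Ω → ℝ, IsLocalTime X P x L) ↔ (d : ℝ) < ∑ j, 1 / H j := by
  exact mainTheorem2_general hN P P₀ X₀ hX₀ X hXmeas hX H (fun j => (hH j).1) hC1 hC2 x
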